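/- Let $d,m\ge 1$ be integers, let $\theta_1,\dots,\theta_m$ be distinct nonzero real numbers, let $2\le p_j<\infty$ for $j=1,\dots,m$, and let $p$ be given by $\frac1p=\sum_{j=1}^m\frac1{p_j}$; assume that $1\le p<\infty$. For $u\in\mathbb Z^d$ put $Q_u=u+[0,1)^d$, and let $p'$ be the dual exponent of $p$ (with $1'=\infty$). For a measurable function $K:\mathbb R^d\to\mathbb C$ put $$B=\sum_{u\in\mathbb Z^d}\|\chi_{Q_u}K\|_{L^{p'}(\mathbb R^d)}\ \text{ if } 1\le p<2,\qquad B=\sum_{u\in\mathbb Z^d}\|\chi_{Q_u}K\|_{L^{2}(\mathbb R^d)}\ \text{ if } 2\le p<\infty,$$ and for $\ell\in\mathbb Z^d$ put $K_\ell(y)=K(y)e^{2\pi i\,\ell\cdot y}$, $$T_\ell(f_1,\dots,f_m)(x)=\int_{\mathbb R^d}f_1(x-\theta_1y)\cdots f_m(x-\theta_my)\,K_\ell(y)\,dy,\qquad T(f_1,\dots,f_m)(x)=\Big(\sum_{\ell\in\mathbb Z^d}|T_\ell(f_1,\dots,f_m)(x)|^2\Big)^{1/2}.$$ Then there is a constant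 $C>0$, depending only on $d$, $m$, the $\theta_j$ and the $p_j$, such that for every measurable $K$ with $B<\infty$ and all complex-valued $f_j\in L^{p_j}(\mathbb R^d)$, $j=1,\dots,m$, the integrals defining $T_\ell(f_1,\dots,f_m)(x)$, $\ell\in\mathbb Z^d$, converge absolutely for almost every $x$, the function $T(f_1,\dots,f_m)$ belongs to $L^p(\mathbb R^d)$, and $$\|T(f_1,\dots,f_m)\|_{L^p(\mathbb R^d)}\le C\,B\prod_{j=1}^m\|f_j\|_{L^{p_j}(\mathbb R^d)}.$$ -/

import Mathlib

open MeasureTheory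
open scoped ENNReal

noncomputable section

namespace SquareFunction

/-- The half-open unit cube `Q_u = u + [0,1)^d`. -/
def cube {d : ℕ} (u : Fin d → ℤ) : Set (EuclideanSpace ℝ (Fin d)) :=
  {x | ∀ i, (u i : ℝ) ≤ x i ∧ x i < (u i : ℝ) + 1}

/-- The modulated kernel `K_ℓ(y) = K(y) e^{2 π i ℓ · y}`. -/
def modulatedKernel {d : ℕ} (K : EuclideanSpace ℝ (Fin d) → ℂ) (l : Fin d → ℤ)
    (y : EuclideanSpace ℝ (Fin d)) : ℂ :=
  K y * Complex.exp (2 * Real.pi * Complex.I * ((∑ i, (l i : ℝ) * y i : ℝ) : ℂ))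

/-- The integrand `y ↦ f_1(x - θ_1 y) ⋯ f_m(x - θ_m y) k(y)`. -/
def multilinearIntegrand {d m : ℕ} (θ : Fin m → ℝ) (k : EuclideanSpace ℝ (Fin d) → ℂ)
    (f : Fin m → EuclideanSpace ℝ (Fin d) → ℂ) (x y : EuclideanSpace ℝ (Fin d)) : ℂ :=
  (∏ j, f j (x - θ j • y)) * k y

/-- `T_ℓ(f_1, …, f_m)(x) = ∫ f_1(x - θ_1 y) ⋯ f_m(x - θ_m y) K_ℓ(y) dy`. -/
def pieceOp {d m : ℕ} (θ : Fin m → ℝ) (K : EuclideanSpace ℝ (Fin d) → ℂ) (l : Fin d → ℤ)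
    (f : Fin m → EuclideanSpace ℝ (Fin d) → ℂ) (x : EuclideanSpace ℝ (Fin d)) : ℂ :=
  ∫ y, multilinearIntegrand θ (modulatedKernel K l) f x y

/-- `T(f_1, …, f_m)(x) = (∑_ℓ |T_ℓ(f_1, …, f_m)(x)|²)^{1/2}`, with values in `[0, ∞]`. -/
def squareFunction {d m : ℕ} (θ : Fin m → ℝ) (K : EuclideanSpace ℝ (Fin d) → ℂ)
    (f : Fin m → EuclideanSpace ℝ (Fin d) → ℂ) (x : EuclideanSpace ℝ (Fin d)) : ℝ≥0∞ :=
  (∑' l : Fin d → ℤ, ‖pieceOp θ K l f x‖ₑ ^ 2) ^ (1 / 2 : ℝ)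

/-- The exponent in the kernel condition: the dual exponent `p'` of `p` when `p < 2`
(so `∞` when `p = 1`), and `2` when `2 ≤ p`. -/
def kernelExponent (p : ℝ≥0∞) : ℝ≥0∞ :=
  if p < 2 then p.conjExponent else 2

/-- The kernel quantity `B`: it is `∑_u ‖χ_{Q_u} K‖_{L^{p'}}` when `p < 2` and
`∑_u ‖χ_{Q_u} K‖_{L²}` when `2 ≤ p`. -/
def kernelConst {d : ℕ} (p : ℝ≥0∞) (K : EuclideanSpace ℝ (Fin d) → ℂ) : ℝ≥0∞ :=
  ∑' u : Fin d → ℤ, eLpNorm ((cube u).indicator K) (kernelExponent p) volume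

end SquareFunction

end

/-! Write F_x(y) = ∏ f_j(x - θ_j y). The characters are orthonormal on every unit cube, so Bessel's
inequality on Q_u bounds the ℓ² norm over ℓ of the coefficients of F_x K by S_u(x) = ‖F_x
K‖_{L²(Q_u)}. Minkowski in ℓ² gives T ≤ ∑_u S_u wherever F_x K is integrable, and Minkowski in L^p
reduces everything to a bound ‖S_u‖_p ≤ C ‖χ_{Q_u} K‖ ∏ ‖f_j‖ uniform in u
(`exists_lintegral_cube_rpow_le`). Almost everywhere finiteness of ∑_u S_u also yields the absolute
convergence.

For p ≥ 2 this is Jensen for the measure |K|² dy, then Fubini and Hölder in x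
(`lintegral_rpow_shear_le_of_two_le`).

For p < 2, start from an L² bound in (x, y) jointly, with ‖k‖_{p'} on the right. Since 2/p' + ∑
2/q_j = 2 with all terms in [0,1], it interpolates between cases where only two factors survive
(`lintegral_prod_rpow_le_of_pairwise`); any two of the forms y, x - θ_j y are independent
coordinates because the θ_j are distinct, so those integrals factor. If p = 1, the kernel comes out
in sup norm. The kernel being supported in a ball, x in a unit ball sees each f_j only on a ball of
fixed size; there Hölder lowers the exponent from 2 to p, and averaging over centres with ∑ p/q_j =
1 reassembles the global bound (`lintegral_rpow_shear_le_of_local`). -/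

/-! ### Interpolation over the hypersimplex -/

/-- Hölder's inequality for weights in the hypersimplex `{w ∈ [0,1]^ι, ∑ w = 2}`: pairwise bounds
interpolate to a bound for the weighted product. -/
theorem lintegral_prod_rpow_le_of_pairwise {α ι : Type*} [MeasurableSpace α] [Fintype ι]
    [DecidableEq ι] {μ : Measure α} {G : ι → α → ℝ≥0∞} (hG : ∀ i, AEMeasurable (G i) μ)
    {A : ι → ℝ≥0∞} {C : ℝ≥0∞}
    (hpair : ∀ i j, i ≠ j → ∫⁻ a, G i a * G j a ∂μ ≤ C * (A i * A j))
    {w : ι → ℝ} (h0 : ∀ i, 0 ≤ w i) (h1 : ∀ i, w i ≤ 1) (hsum : ∑ i, w i = 2) :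
    ∫⁻ a, ∏ i, G i a ^ w i ∂μ ≤ C * ∏ i, A i ^ w i := by
  -- induction on the number of fractional weights
  induction hn : (Finset.univ.filter fun i => w i ≠ 0 ∧ w i ≠ 1).card using Nat.strong_induction_on
    generalizing w with
  | _ n ih =>
  by_cases hfrac : ∃ i, w i ≠ 0 ∧ w i ≠ 1
  · obtain ⟨i, hi0, hi1⟩ := hfrac
    -- there is a second fractional weight, since the sum is an integer
    obtain ⟨k, hki, hk0, hk1⟩ : ∃ k, k ≠ i ∧ w k ≠ 0 ∧ w k ≠ 1 := by
      by_contra! hcon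
      have hint : ∀ s : Finset ι, i ∉ s → ∃ z : ℤ, ∑ j ∈ s, w j = z := by
        intro s
        induction s using Finset.induction with
        | empty => exact fun _ => ⟨0, by simp⟩
        | insert a s ha ihs =>
          intro hs
          simp only [Finset.mem_insert, not_or] at hs
          obtain ⟨z, hz⟩ := ihs hs.2
          rw [Finset.sum_insert ha, hz]
          by_cases ha0 : w a = 0
          · exact ⟨z, by simp [ha0]⟩
          · exact ⟨1 + z, by simp [hcon a (Ne.symm hs.1) ha0]⟩
      obtain ⟨z, hz⟩ := hint (Finset.univ.erase i) (by simp)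
      have hs := Finset.add_sum_erase Finset.univ w (Finset.mem_univ i)
      rw [hz, hsum] at hs
      have hwi : w i = ((2 - z : ℤ) : ℝ) := by push_cast; linarith
      have hpos : (0 : ℝ) < w i := lt_of_le_of_ne (h0 i) (Ne.symm hi0)
      have hlt : w i < 1 := lt_of_le_of_ne (h1 i) hi1
      rw [hwi] at hpos hlt
      have hpos' : (0 : ℤ) < 2 - z := by exact_mod_cast hpos
      have hlt' : (2 - z : ℤ) < 1 := by exact_mod_cast hlt
      omega
    have hipos : 0 < w i := lt_of_le_of_ne (h0 i) (Ne.symm hi0)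
    have hilt : w i < 1 := lt_of_le_of_ne (h1 i) hi1
    have hkpos : 0 < w k := lt_of_le_of_ne (h0 k) (Ne.symm hk0)
    have hklt : w k < 1 := lt_of_le_of_ne (h1 k) hk1
    -- moving mass between two fractional weights until one of them is an integer
    have key : ∀ i k : ι, k ≠ i → 0 < w i → w i < 1 → 0 < w k → w k < 1 →
        ∃ s : ℝ, 0 < s ∧ ∫⁻ a, ∏ j, G j a ^ (w j + s * ((Pi.single i 1 : ι → ℝ) j -
          (Pi.single k 1 : ι → ℝ) j)) ∂μ ≤
          C * ∏ j, A j ^ (w j + s * ((Pi.single i 1 : ι → ℝ) j - (Pi.single k 1 : ι → ℝ) j)) ∧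
          ∀ j, 0 ≤ w j + s * ((Pi.single i 1 : ι → ℝ) j - (Pi.single k 1 : ι → ℝ) j) := by
      intro i k hki hipos hilt hkpos hklt
      set s := min (1 - w i) (w k) with hs
      have hspos : 0 < s := lt_min (by linarith) hkpos
      have hs1 : s ≤ 1 - w i := min_le_left _ _
      have hs2 : s ≤ w k := min_le_right _ _
      set w' : ι → ℝ := fun j => w j + s * ((Pi.single i 1 : ι → ℝ) j - (Pi.single k 1 : ι → ℝ) j)
        with hw'
      have hwi : w' i = w i + s := by simp [hw', hki.symm]
      have hwk : w' k = w k - s := by simp [hw', hki]; ring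
      have hwj : ∀ j, j ≠ i → j ≠ k → w' j = w j := fun j hji hjk => by simp [hw', hji, hjk]
      have hw0 : ∀ j, 0 ≤ w' j := by
        intro j
        rcases eq_or_ne j i with rfl | hji
        · rw [hwi]; linarith
        rcases eq_or_ne j k with rfl | hjk
        · rw [hwk]; linarith
        rw [hwj j hji hjk]; exact h0 j
      refine ⟨s, hspos, ?_, hw0⟩
      refine ih _ ?_ (w := w') hw0 ?_ ?_ rfl
      · rw [← hn]
        apply Finset.card_lt_card
        rw [Finset.ssubset_iff_of_subset]
        · rcases le_total (1 - w i) (w k) with h | h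
          · refine ⟨i, by simp [hipos.ne', hilt.ne], ?_⟩
            have : w' i = 1 := by rw [hwi, hs, min_eq_left h]; ring
            simp [this]
          · refine ⟨k, by simp [hkpos.ne', hklt.ne], ?_⟩
            have : w' k = 0 := by rw [hwk, hs, min_eq_right h]; ring
            simp [this]
        · intro j hj
          simp only [Finset.mem_filter, Finset.mem_univ, true_and] at hj ⊢
          rcases eq_or_ne j i with rfl | hji
          · exact ⟨hipos.ne', hilt.ne⟩
          rcases eq_or_ne j k with rfl | hjk
          · exact ⟨hkpos.ne', hklt.ne⟩
          rwa [hwj j hji hjk] at hj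
      · intro j
        rcases eq_or_ne j i with rfl | hji
        · rw [hwi]; linarith
        rcases eq_or_ne j k with rfl | hjk
        · rw [hwk]; linarith
        rw [hwj j hji hjk]; exact h1 j
      · simp [hw', Finset.sum_add_distrib, ← Finset.mul_sum, hsum]
    obtain ⟨s, hs, hsb, hs0⟩ := key i k hki hipos hilt hkpos hklt
    obtain ⟨t, ht, htb, ht0⟩ := key k i hki.symm hkpos hklt hipos hilt
    set u : ι → ℝ := fun j => w j + s * ((Pi.single i 1 : ι → ℝ) j - (Pi.single k 1 : ι → ℝ) j)
    set v : ι → ℝ := fun j => w j + t * ((Pi.single k 1 : ι → ℝ) j - (Pi.single i 1 : ι → ℝ) j)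
    have hst : 0 < s + t := by positivity
    -- The new weights `u` and `v` are displaced from `w` by `s` and `t` in opposite directions, so
    -- these coefficients make `w` their convex combination; Hölder then interpolates the two
    -- inductive bounds.
    set a := t / (s + t)
    set b := s / (s + t)
    have ha : 0 ≤ a := by positivity
    have hb : 0 ≤ b := by positivity
    have hab : a + b = 1 := by simp only [a, b]; field_simp; ring
    have hw : ∀ j, w j = u j * a + v j * b := by
      intro j; simp only [u, v, a, b]; field_simp; ring
    have split : ∀ X : ι → ℝ≥0∞, ∏ j, X j ^ w j = (∏ j, X j ^ u j) ^ a * (∏ j, X j ^ v j) ^ b := by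
      intro X
      rw [← ENNReal.prod_rpow_of_nonneg ha, ← ENNReal.prod_rpow_of_nonneg hb,
        ← Finset.prod_mul_distrib]
      refine Finset.prod_congr rfl fun j _ => ?_
      rw [hw j, ENNReal.rpow_add_of_nonneg _ _ (mul_nonneg (hs0 j) ha) (mul_nonneg (ht0 j) hb),
        ENNReal.rpow_mul, ENNReal.rpow_mul]
    calc ∫⁻ x, ∏ j, G j x ^ w j ∂μ
        = ∫⁻ x, (∏ j, G j x ^ u j) ^ a * (∏ j, G j x ^ v j) ^ b ∂μ := by
          simp_rw [fun x => split (fun j => G j x)]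
      _ ≤ (∫⁻ x, ∏ j, G j x ^ u j ∂μ) ^ a * (∫⁻ x, ∏ j, G j x ^ v j ∂μ) ^ b :=
          ENNReal.lintegral_mul_norm_pow_le
            (Finset.aemeasurable_fun_prod _ fun j _ => (hG j).pow_const _)
            (Finset.aemeasurable_fun_prod _ fun j _ => (hG j).pow_const _) ha hb hab
      _ ≤ (C * ∏ j, A j ^ u j) ^ a * (C * ∏ j, A j ^ v j) ^ b := by gcongr
      _ = C * ∏ j, A j ^ w j := by
          rw [ENNReal.mul_rpow_of_nonneg _ _ ha, ENNReal.mul_rpow_of_nonneg _ _ hb, split A,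
            mul_mul_mul_comm, ← ENNReal.rpow_add_of_nonneg _ _ ha hb, hab, ENNReal.rpow_one]
  -- Vertex case: weights in {0,1} of sum 2 select exactly two indices, which is the pairwise
  -- hypothesis.
  · push Not at hfrac
    set s := Finset.univ.filter fun i => w i = 1 with hs
    have hw : ∀ i, w i = if i ∈ s then 1 else 0 := by
      intro i
      by_cases h : w i = 0
      · simp [hs, h]
      · simp [hs, hfrac i h]
    have hcard : s.card = 2 := by
      have : (s.card : ℝ) = 2 := by
        rw [← hsum, Finset.sum_congr rfl fun i _ => hw i]; simp
      exact_mod_cast this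
    obtain ⟨i, j, hij, hsij⟩ := Finset.card_eq_two.1 hcard
    have hprod : ∀ X : ι → ℝ≥0∞, ∏ l, X l ^ w l = X i * X j := by
      intro X
      rw [Finset.prod_congr rfl fun l _ => by rw [hw l], ← Finset.prod_pair hij, ← hsij]
      rw [← Finset.prod_subset (Finset.subset_univ s)]
      · exact Finset.prod_congr rfl fun l hl => by simp [hl]
      · intro l _ hl; simp [hl]
    simp_rw [fun x => hprod (fun l => G l x), hprod]
    exact hpair i j hij

/-! ### Minkowski's inequality for countable sums -/

/-- Minkowski's inequality for countable sums of `ℝ≥0∞`-valued functions. -/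
theorem lintegral_tsum_rpow_le {α ι : Type*} [MeasurableSpace α] [Countable ι] {μ : Measure α}
    {f : ι → α → ℝ≥0∞} (hf : ∀ i, AEMeasurable (f i) μ) {p : ℝ} (hp : 1 ≤ p) :
    (∫⁻ a, (∑' i, f i a) ^ p ∂μ) ^ (1 / p) ≤ ∑' i, (∫⁻ a, f i a ^ p ∂μ) ^ (1 / p) := by
  have hp0 : 0 < p := by linarith
  have hfin : ∀ s : Finset ι, (∫⁻ a, (∑ i ∈ s, f i a) ^ p ∂μ) ^ (1 / p) ≤
      ∑ i ∈ s, (∫⁻ a, f i a ^ p ∂μ) ^ (1 / p) := by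
    classical
    intro s
    induction s using Finset.induction with
    | empty => simp [hp0]
    | insert a s ha ih =>
      simp_rw [Finset.sum_insert ha]
      exact (ENNReal.lintegral_Lp_add_le (hf a) (Finset.aemeasurable_fun_sum _ fun i _ => hf i)
        hp).trans (by gcongr)
  have hsup : ∀ a, (∑' i, f i a) ^ p = ⨆ s : Finset ι, (∑ i ∈ s, f i a) ^ p := by
    intro a
    rw [ENNReal.tsum_eq_iSup_sum]
    exact (ENNReal.orderIsoRpow p hp0).map_iSup _
  simp_rw [hsup]
  rw [lintegral_iSup_directed]
  · rw [one_div, ENNReal.rpow_inv_le_iff hp0]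
    refine iSup_le fun s => ?_
    rw [← ENNReal.rpow_inv_le_iff hp0, ← one_div]
    exact (hfin s).trans (ENNReal.sum_le_tsum s)
  · exact fun s => (Finset.aemeasurable_fun_sum _ fun i _ => hf i).pow_const _
  · refine Monotone.directed_le fun s t hst a => ?_
    dsimp only
    gcongr

/-- The case of counting measure; on the discrete σ-algebra measurability is free. -/
theorem tsum_tsum_rpow_le {κ ι : Type*} [Countable κ] [Countable ι] (f : ι → κ → ℝ≥0∞) {p : ℝ}
    (hp : 1 ≤ p) :
    (∑' a, (∑' i, f i a) ^ p) ^ (1 / p) ≤ ∑' i, (∑' a, f i a ^ p) ^ (1 / p) := by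
  let _ : MeasurableSpace κ := ⊤
  simpa [lintegral_count] using
    lintegral_tsum_rpow_le (μ := Measure.count) (f := f) (fun i => measurable_from_top.aemeasurable)
      hp

/-! ### Changes of variables by shears -/

section Shear

variable {E : Type*} [NormedAddCommGroup E] [NormedSpace ℝ E] [FiniteDimensional ℝ E]
  [MeasurableSpace E] [BorelSpace E] (μ : Measure E) [μ.IsAddHaarMeasure]

theorem lintegral_comp_const_add_smul {f : E → ℝ≥0∞} (hf : Measurable f) {c : ℝ} (hc : c ≠ 0)
    (x : E) : ∫⁻ y, f (x + c • y) ∂μ =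
      ENNReal.ofReal |(c ^ Module.finrank ℝ E)⁻¹| * ∫⁻ y, f y ∂μ := by
  have h := lintegral_map (μ := μ) (f := fun y => f (x + y)) (g := fun y : E => c • y)
    (by fun_prop) (by fun_prop)
  rw [← h]
  erw [Measure.map_addHaar_smul μ hc]
  rw [lintegral_smul_measure, lintegral_add_left_eq_self f x, smul_eq_mul]

theorem lintegral_lintegral_shear_mul {f g : E → ℝ≥0∞} (hf : Measurable f) (hg : Measurable g)
    {a b : ℝ} (hab : a ≠ b) :
    ∫⁻ z, f (z.1 - a • z.2) * g (z.1 - b • z.2) ∂(μ.prod μ) =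
      ENNReal.ofReal |((a - b) ^ Module.finrank ℝ E)⁻¹| * ((∫⁻ x, f x ∂μ) * ∫⁻ x, g x ∂μ) := by
  have h1 : ∀ y : E, ∫⁻ x, f (x - a • y) * g (x - b • y) ∂μ =
      ∫⁻ x, f x * g (x + (a - b) • y) ∂μ := by
    intro y
    -- Translating `x` by `a • y` frees the first factor from `y`; the remaining `y`-integral is a
    -- dilation by `a - b`.
    rw [← lintegral_sub_right_eq_self (fun x => f x * g (x + (a - b) • y)) (a • y)]
    congr! 4 with x
    module
  rw [lintegral_prod_symm _ (by fun_prop)]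
  simp_rw [h1]
  rw [lintegral_lintegral_swap (by fun_prop)]
  simp_rw [fun x => lintegral_const_mul (μ := μ) (f x)
    (f := fun y => g (x + (a - b) • y)) (by fun_prop),
    lintegral_comp_const_add_smul μ hg (sub_ne_zero.2 hab)]
  rw [lintegral_mul_const _ hf]
  ring

theorem lintegral_shear_mul_snd {f g : E → ℝ≥0∞} (hf : Measurable f) (hg : Measurable g) (b : ℝ) :
    ∫⁻ z, f z.2 * g (z.1 - b • z.2) ∂(μ.prod μ) = (∫⁻ x, f x ∂μ) * ∫⁻ x, g x ∂μ := by
  rw [lintegral_prod_symm _ (by fun_prop)]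
  simp_rw [fun y => lintegral_const_mul (μ := μ) (f y) (f := fun x => g (x - b • y)) (by fun_prop),
    fun y => lintegral_sub_right_eq_self (μ := μ) g (b • y)]
  rw [lintegral_mul_const _ hf]

end Shear

section ShearConst

variable {E : Type*} [NormedAddCommGroup E] [NormedSpace ℝ E] {ι : Type*} [Fintype ι]

/-- A finite constant dominating `1` and all Jacobian factors of the shears `θ i`, `θ j`. -/
noncomputable def shearConst (E : Type*) [NormedAddCommGroup E] [NormedSpace ℝ E]
    {ι : Type*} [Fintype ι] (θ : ι → ℝ) : ℝ≥0∞ :=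
  1 + ∑ i, ∑ j, ENNReal.ofReal |((θ i - θ j) ^ Module.finrank ℝ E)⁻¹|

theorem shearConst_lt_top (θ : ι → ℝ) : shearConst E θ < ∞ := by
  simp [shearConst, ENNReal.sum_lt_top]

theorem one_le_shearConst (θ : ι → ℝ) : 1 ≤ shearConst E θ := le_self_add

theorem ofReal_le_shearConst (θ : ι → ℝ) (i j : ι) :
    ENNReal.ofReal |((θ i - θ j) ^ Module.finrank ℝ E)⁻¹| ≤ shearConst E θ := by
  refine le_add_left ?_
  refine le_trans ?_ (Finset.single_le_sum (fun _ _ => zero_le) (Finset.mem_univ i))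
  exact Finset.single_le_sum
    (f := fun j => ENNReal.ofReal |((θ i - θ j) ^ Module.finrank ℝ E)⁻¹|)
    (fun _ _ => zero_le) (Finset.mem_univ j)

end ShearConst

theorem rpow_rpow_two_div (a : ℝ≥0∞) {q : ℝ} (hq : 0 < q) : (a ^ q) ^ (2 / q) = a ^ 2 := by
  rw [← ENNReal.rpow_mul, mul_div_cancel₀ _ hq.ne', ENNReal.rpow_two]

/-! ### Estimates for a single nonnegative kernel -/

section Core

variable {E : Type*} [NormedAddCommGroup E] [NormedSpace ℝ E] [FiniteDimensional ℝ E]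
  [MeasurableSpace E] [BorelSpace E] (μ : Measure E) [μ.IsAddHaarMeasure]
  {ι : Type*} [Fintype ι]

theorem lintegral_prod_shear_sq_le {θ : ι → ℝ} (hθ : Function.Injective θ) {q : ι → ℝ}
    (hq : ∀ j, 2 ≤ q j) (hsum : ∑ j, 2 / q j = 2) {g : ι → E → ℝ≥0∞}
    (hg : ∀ j, Measurable (g j)) :
    ∫⁻ z, ∏ j, g j (z.1 - θ j • z.2) ^ 2 ∂(μ.prod μ) ≤
      shearConst E θ * ∏ j, (∫⁻ x, g j x ^ q j ∂μ) ^ (2 / q j) := by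
  classical
  have hq0 : ∀ j, 0 < q j := fun j => by linarith [hq j]
  have h := lintegral_prod_rpow_le_of_pairwise (μ := μ.prod μ)
    (G := fun j z => g j (z.1 - θ j • z.2) ^ q j) (A := fun j => ∫⁻ x, g j x ^ q j ∂μ)
    (C := shearConst E θ) (w := fun j => 2 / q j)
    (fun j => by have := hg j; fun_prop) ?_ (fun j => (div_pos two_pos (hq0 j)).le)
    (fun j => (div_le_one (hq0 j)).2 (hq j)) hsum
  · simpa only [rpow_rpow_two_div _ (hq0 _)] using h
  · intro i j hij
    rw [lintegral_lintegral_shear_mul μ (f := fun x => g i x ^ q i) (g := fun x => g j x ^ q j)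
      ((hg i).pow_const _) ((hg j).pow_const _) (hθ.ne hij)]
    gcongr
    exact ofReal_le_shearConst θ i j

/-- The kernel joins the interpolation as one more factor, indexed by `none`. Pairing it with any `g
j` gives Jacobian 1, whatever `θ j` is. -/
theorem lintegral_snd_mul_prod_shear_sq_le {θ : ι → ℝ} (hθ : Function.Injective θ) {q : ι → ℝ}
    (hq : ∀ j, 2 ≤ q j) {r : ℝ} (hr : 2 ≤ r) (hsum : 2 / r + ∑ j, 2 / q j = 2)
    {k : E → ℝ≥0∞} (hk : Measurable k) {g : ι → E → ℝ≥0∞} (hg : ∀ j, Measurable (g j)) :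
    ∫⁻ z, k z.2 ^ 2 * ∏ j, g j (z.1 - θ j • z.2) ^ 2 ∂(μ.prod μ) ≤
      shearConst E θ *
        ((∫⁻ x, k x ^ r ∂μ) ^ (2 / r) * ∏ j, (∫⁻ x, g j x ^ q j ∂μ) ^ (2 / q j)) := by
  classical
  have hq0 : ∀ j, 0 < q j := fun j => by linarith [hq j]
  have hr0 : 0 < r := by linarith
  have h := lintegral_prod_rpow_le_of_pairwise (μ := μ.prod μ) (ι := Option ι)
    (G := fun o z => o.elim (k z.2 ^ r) fun j => g j (z.1 - θ j • z.2) ^ q j)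
    (A := fun o => o.elim (∫⁻ x, k x ^ r ∂μ) fun j => ∫⁻ x, g j x ^ q j ∂μ)
    (C := shearConst E θ) (w := fun o => o.elim (2 / r) fun j => 2 / q j)
    ?_ ?_ ?_ ?_ ?_
  · simpa only [Fintype.prod_option, Option.elim, rpow_rpow_two_div _ (hq0 _),
      rpow_rpow_two_div _ hr0] using h
  · rintro (_ | j)
    · simp only [Option.elim]; fun_prop
    · have := hg j
      simp only [Option.elim]; fun_prop
  · have hnone : ∀ j, ∫⁻ z, k z.2 ^ r * g j (z.1 - θ j • z.2) ^ q j ∂(μ.prod μ) ≤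
        shearConst E θ * ((∫⁻ x, k x ^ r ∂μ) * ∫⁻ x, g j x ^ q j ∂μ) := by
      intro j
      rw [lintegral_shear_mul_snd μ (f := fun x => k x ^ r) (g := fun x => g j x ^ q j)
        (hk.pow_const _) ((hg j).pow_const _)]
      exact le_mul_of_one_le_left zero_le (one_le_shearConst θ)
    rintro (_ | i) (_ | j) hij
    · exact absurd rfl hij
    · exact hnone j
    · simp only [Option.elim]
      simp_rw [mul_comm (_ ^ q i) (k _ ^ r)]
      rw [mul_comm (∫⁻ x, g i x ^ q i ∂μ)]
      exact hnone i
    · simp only [Option.elim]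
      rw [lintegral_lintegral_shear_mul μ (f := fun x => g i x ^ q i) (g := fun x => g j x ^ q j)
        ((hg i).pow_const _) ((hg j).pow_const _) (hθ.ne (by simpa using hij))]
      gcongr
      exact ofReal_le_shearConst θ i j
  · rintro (_ | j)
    · simp only [Option.elim]; positivity
    · exact (div_pos two_pos (hq0 j)).le
  · rintro (_ | j)
    · exact (div_le_one hr0).2 hr
    · exact (div_le_one (hq0 j)).2 (hq j)
  · simpa only [Fintype.sum_option, Option.elim] using hsum

theorem measurable_lintegral_ball {h : E → ℝ≥0∞} (hh : Measurable h) (v : E) (R : ℝ) :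
    Measurable fun z => ∫⁻ x in Metric.ball (z - v) R, h x ∂μ := by
  simp_rw [← lintegral_indicator Metric.isOpen_ball.measurableSet]
  refine Measurable.lintegral_prod_right'
    (f := fun w : E × E => (Metric.ball (w.1 - v) R).indicator h w.2) ?_
  have : (fun w : E × E => (Metric.ball (w.1 - v) R).indicator h w.2) =
      {w : E × E | dist w.2 (w.1 - v) < R}.indicator fun w => h w.2 := by
    ext w; simp [Set.indicator]
  rw [this]
  exact Measurable.indicator (by fun_prop) (measurableSet_lt (by fun_prop) (by fun_prop))

/-- By Tonelli: each `x` lies in the moving ball for a set of centres `z` of measure `μ (ball 0 R)`.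
-/
theorem lintegral_lintegral_ball {h : E → ℝ≥0∞} (hh : Measurable h) (v : E) (R : ℝ) :
    ∫⁻ z, ∫⁻ x in Metric.ball (z - v) R, h x ∂μ ∂μ = μ (Metric.ball 0 R) * ∫⁻ x, h x ∂μ := by
  have hind : ∀ z x : E, (Metric.ball (z - v) R).indicator h x =
      (Metric.ball (x + v) R).indicator (fun _ => h x) z := by
    intro z x
    simp only [Set.indicator, Metric.mem_ball, dist_eq_norm]
    congr 2
    rw [← norm_neg]; congr 1; abel
  simp_rw [← lintegral_indicator Metric.isOpen_ball.measurableSet]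
  rw [lintegral_lintegral_swap]
  · simp_rw [hind, lintegral_indicator Metric.isOpen_ball.measurableSet, lintegral_const,
      Measure.restrict_apply MeasurableSet.univ, Set.univ_inter]
    simp_rw [fun x : E => μ.addHaar_ball_center (x + v) R]
    rw [lintegral_mul_const _ hh, mul_comm]
  · have : (Function.uncurry fun z x : E => (Metric.ball (z - v) R).indicator h x) =
      {w : E × E | dist w.2 (w.1 - v) < R}.indicator fun w => h w.2 := by
      ext w; simp [Set.indicator, Function.uncurry]
    rw [this]
    exact (Measurable.indicator (by fun_prop)
      (measurableSet_lt (by fun_prop) (by fun_prop))).aemeasurable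

theorem measurable_lintegral_shear {k : E → ℝ≥0∞} (hk : Measurable k) {g : ι → E → ℝ≥0∞}
    (hg : ∀ j, Measurable (g j)) (θ : ι → ℝ) :
    Measurable fun x => ∫⁻ y, k y ^ 2 * ∏ j, g j (x - θ j • y) ^ 2 ∂μ := by
  refine Measurable.lintegral_prod_right'
    (f := fun w : E × E => k w.2 ^ 2 * ∏ j, g j (w.1 - θ j • w.2) ^ 2) ?_
  fun_prop

/-- Localization to balls: a bound in `L²` over the product space upgrades to an `L^p` bound,
`p ≤ 2`, for the square function of a kernel supported in a ball of radius `ρ`. -/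
theorem lintegral_rpow_shear_le_of_local {θ : ι → ℝ} {q : ι → ℝ} (hq : ∀ j, 0 < q j)
    {p : ℝ} (hp0 : 0 < p) (hp2 : p ≤ 2) (hsum : ∑ j, p / q j = 1)
    {k : E → ℝ≥0∞} (hk : Measurable k) {c : E} {ρ : ℝ}
    (hsupp : ∀ y, k y ≠ 0 → y ∈ Metric.ball c ρ) {M : ℝ≥0∞}
    (hloc : ∀ g : ι → E → ℝ≥0∞, (∀ j, Measurable (g j)) →
      ∫⁻ z, k z.2 ^ 2 * ∏ j, g j (z.1 - θ j • z.2) ^ 2 ∂(μ.prod μ) ≤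
        M * ∏ j, (∫⁻ x, g j x ^ q j ∂μ) ^ (2 / q j))
    {g : ι → E → ℝ≥0∞} (hg : ∀ j, Measurable (g j)) :
    ∫⁻ x, (∫⁻ y, k y ^ 2 * ∏ j, g j (x - θ j • y) ^ 2 ∂μ) ^ (p / 2) ∂μ ≤
      ((μ (Metric.ball (0 : E) 1))⁻¹ * μ (Metric.ball (0 : E) 1) ^ (1 - p / 2) *
        ∏ j, μ (Metric.ball (0 : E) (1 + |θ j| * ρ)) ^ (p / q j)) *
        M ^ (p / 2) * ∏ j, (∫⁻ x, g j x ^ q j ∂μ) ^ (p / q j) := by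
  set V := μ (Metric.ball (0 : E) 1) with hV
  have hV0 : V ≠ 0 := (Metric.measure_ball_pos μ _ one_pos).ne'
  have hVtop : V ≠ ∞ := measure_ball_lt_top.ne
  set Φ : E → ℝ≥0∞ := fun x => ∫⁻ y, k y ^ 2 * ∏ j, g j (x - θ j • y) ^ 2 ∂μ with hΦ
  have hΦm : Measurable Φ := measurable_lintegral_shear μ hk hg θ
  have hp2' : 0 ≤ 1 - p / 2 := by linarith
  have hpq : ∀ j, 0 ≤ p / q j := fun j => (div_pos hp0 (hq j)).le
  -- If `x ∈ ball z 1` and `y ∈ ball c ρ`, then `x - θ j • y` lies in `S j z`, so truncating `g j`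
  -- to this set changes nothing there.
  set S : ι → E → Set E := fun j z => Metric.ball (z - θ j • c) (1 + |θ j| * ρ) with hS
  have hSm : ∀ j z, MeasurableSet (S j z) := fun j z => Metric.isOpen_ball.measurableSet
  have hball : ∀ z, ∫⁻ x in Metric.ball z 1, Φ x ∂μ ≤
      M * ∏ j, (∫⁻ x in S j z, g j x ^ q j ∂μ) ^ (2 / q j) := by
    intro z
    have h1 := hloc (fun j => (S j z).indicator (g j)) fun j => (hg j).indicator (hSm j z)
    have h2 : ∀ j, ∫⁻ x, (S j z).indicator (g j) x ^ q j ∂μ = ∫⁻ x in S j z, g j x ^ q j ∂μ := by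
      intro j
      rw [← lintegral_indicator (hSm j z)]
      refine lintegral_congr fun x => ?_
      by_cases hx : x ∈ S j z <;> simp [hx, hq j]
    simp only [h2] at h1
    refine le_trans ?_ h1
    have hm : Measurable fun w : E × E =>
        k w.2 ^ 2 * ∏ j, (S j z).indicator (g j) (w.1 - θ j • w.2) ^ 2 := by
      have : ∀ j, Measurable ((S j z).indicator (g j)) := fun j => (hg j).indicator (hSm j z)
      fun_prop
    rw [lintegral_prod _ hm.aemeasurable]
    refine (setLIntegral_mono' Metric.isOpen_ball.measurableSet fun x hx => ?_).trans
      (setLIntegral_le_lintegral _ _)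
    refine lintegral_mono fun y => ?_
    dsimp only
    by_cases hky : k y = 0
    · simp [hky]
    refine le_of_eq ?_
    congr 1
    refine Finset.prod_congr rfl fun j _ => ?_
    rw [Set.indicator_of_mem]
    have hy := hsupp y hky
    simp only [hS, Metric.mem_ball, dist_eq_norm] at hx hy ⊢
    have : x - θ j • y - (z - θ j • c) = (x - z) - θ j • (y - c) := by module
    rw [this]
    calc ‖(x - z) - θ j • (y - c)‖ ≤ ‖x - z‖ + |θ j| * ‖y - c‖ := by
          simpa [norm_smul] using norm_sub_le (x - z) (θ j • (y - c))
      _ < 1 + |θ j| * ρ := add_lt_add_of_lt_of_le hx (by gcongr)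
  have havg : V * ∫⁻ x, Φ x ^ (p / 2) ∂μ = ∫⁻ z, ∫⁻ x in Metric.ball z 1, Φ x ^ (p / 2) ∂μ ∂μ := by
    simpa using (lintegral_lintegral_ball μ (hΦm.pow_const (p / 2)) 0 1).symm
  have hz : ∀ z, ∫⁻ x in Metric.ball z 1, Φ x ^ (p / 2) ∂μ ≤
      V ^ (1 - p / 2) * M ^ (p / 2) * ∏ j, (∫⁻ x in S j z, g j x ^ q j ∂μ) ^ (p / q j) := by
    intro z
    -- Hölder against the constant 1 on a ball of volume `V`: this is where `p ≤ 2` is needed.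
    have h := ENNReal.lintegral_mul_norm_pow_le (μ := μ.restrict (Metric.ball z 1))
      hΦm.aemeasurable (g := fun _ => 1) aemeasurable_const (p := p / 2) (q := 1 - p / 2)
      (by positivity) hp2' (by ring)
    simp only [ENNReal.one_rpow, mul_one, lintegral_const, one_mul,
      Measure.restrict_apply MeasurableSet.univ, Set.univ_inter] at h
    rw [μ.addHaar_ball_center z 1] at h
    refine h.trans ?_
    rw [mul_comm, mul_assoc]
    refine mul_le_mul_right ?_ _
    refine (ENNReal.rpow_le_rpow (hball z) (by positivity)).trans_eq ?_
    rw [ENNReal.mul_rpow_of_nonneg _ _ (by positivity),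
      ← ENNReal.prod_rpow_of_nonneg (by positivity)]
    congr 1
    refine Finset.prod_congr rfl fun j _ => ?_
    rw [← ENNReal.rpow_mul]
    congr 1
    have := (hq j).ne'
    field_simp
  have hprod : ∫⁻ z, ∏ j, (∫⁻ x in S j z, g j x ^ q j ∂μ) ^ (p / q j) ∂μ ≤
      ∏ j, (μ (Metric.ball (0 : E) (1 + |θ j| * ρ)) * ∫⁻ x, g j x ^ q j ∂μ) ^ (p / q j) := by
    have h := ENNReal.lintegral_prod_norm_pow_le (μ := μ) Finset.univ
      (f := fun j z => ∫⁻ x in S j z, g j x ^ q j ∂μ)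
      (fun j _ => (measurable_lintegral_ball μ ((hg j).pow_const (q j)) (θ j • c)
        (1 + |θ j| * ρ)).aemeasurable) hsum fun j _ => hpq j
    refine h.trans_eq (Finset.prod_congr rfl fun j _ => ?_)
    rw [lintegral_lintegral_ball μ ((hg j).pow_const (q j))]
  calc ∫⁻ x, Φ x ^ (p / 2) ∂μ = V⁻¹ * (V * ∫⁻ x, Φ x ^ (p / 2) ∂μ) := by
        rw [← mul_assoc, ENNReal.inv_mul_cancel hV0 hVtop, one_mul]
    _ ≤ V⁻¹ * ∫⁻ z, V ^ (1 - p / 2) * M ^ (p / 2) *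
          ∏ j, (∫⁻ x in S j z, g j x ^ q j ∂μ) ^ (p / q j) ∂μ := by
        rw [havg]; gcongr with z; exact hz z
    _ ≤ V⁻¹ * (V ^ (1 - p / 2) * M ^ (p / 2) *
          ∏ j, (μ (Metric.ball (0 : E) (1 + |θ j| * ρ)) * ∫⁻ x, g j x ^ q j ∂μ) ^ (p / q j)) := by
        rw [lintegral_const_mul]
        · gcongr
        · exact Finset.measurable_fun_prod _ fun j _ => (measurable_lintegral_ball μ
            ((hg j).pow_const (q j)) (θ j • c) (1 + |θ j| * ρ)).pow_const _
    _ = _ := by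
        simp_rw [fun j => ENNReal.mul_rpow_of_nonneg (μ (Metric.ball (0 : E) (1 + |θ j| * ρ)))
          (∫⁻ x, g j x ^ q j ∂μ) (hpq j), Finset.prod_mul_distrib]
        ring

/-- The `L^p` bound, `p ≥ 2`, for the square function of an `L²` kernel. -/
theorem lintegral_rpow_shear_le_of_two_le (θ : ι → ℝ) {q : ι → ℝ} (hq : ∀ j, 0 < q j)
    {p : ℝ} (hp2 : 2 ≤ p) (hsum : ∑ j, p / q j = 1)
    {k : E → ℝ≥0∞} (hk : Measurable k) {g : ι → E → ℝ≥0∞} (hg : ∀ j, Measurable (g j)) :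
    ∫⁻ x, (∫⁻ y, k y ^ 2 * ∏ j, g j (x - θ j • y) ^ 2 ∂μ) ^ (p / 2) ∂μ ≤
      (∫⁻ y, k y ^ 2 ∂μ) ^ (p / 2) * ∏ j, (∫⁻ x, g j x ^ q j ∂μ) ^ (p / q j) := by
  have hp0 : 0 < p := by linarith
  have hpp : 0 ≤ p / 2 - 1 := by linarith
  have hpp' : 0 ≤ 1 - 2 / p := by
    rw [sub_nonneg, div_le_one hp0]; exact hp2
  have hpq : ∀ j, 0 ≤ p / q j := fun j => (div_pos hp0 (hq j)).le
  set N := ∫⁻ y, k y ^ 2 ∂μ with hN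
  have hm : Measurable fun w : E × E => k w.2 ^ 2 * ∏ j, g j (w.1 - θ j • w.2) ^ p := by fun_prop
  -- Jensen for the unnormalised measure `k² dy`, done as Hölder with exponents `2/p` and `1 - 2/p`
  -- after splitting `k²` accordingly; this also covers infinite mass.
  have hjensen : ∀ x, (∫⁻ y, k y ^ 2 * ∏ j, g j (x - θ j • y) ^ 2 ∂μ) ^ (p / 2) ≤
      N ^ (p / 2 - 1) * ∫⁻ y, k y ^ 2 * ∏ j, g j (x - θ j • y) ^ p ∂μ := by
    intro x
    have h := ENNReal.lintegral_mul_norm_pow_le (μ := μ)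
      (f := fun y => k y ^ 2 * ∏ j, g j (x - θ j • y) ^ p) (g := fun y => k y ^ 2)
      (by fun_prop) (by fun_prop) (p := 2 / p) (q := 1 - 2 / p)
      (by positivity) hpp' (by ring)
    have heq : ∀ y, (k y ^ 2 * ∏ j, g j (x - θ j • y) ^ p) ^ (2 / p) * (k y ^ 2) ^ (1 - 2 / p) =
        k y ^ 2 * ∏ j, g j (x - θ j • y) ^ 2 := by
      intro y
      rw [ENNReal.mul_rpow_of_nonneg _ _ (by positivity), mul_right_comm,
        ← ENNReal.rpow_add_of_nonneg _ _ (by positivity) hpp', add_sub_cancel, ENNReal.rpow_one,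
        ← ENNReal.prod_rpow_of_nonneg (by positivity)]
      congr 1
      exact Finset.prod_congr rfl fun j _ => rpow_rpow_two_div _ hp0
    simp_rw [heq] at h
    refine (ENNReal.rpow_le_rpow h (by positivity)).trans_eq ?_
    rw [ENNReal.mul_rpow_of_nonneg _ _ (by positivity), ← ENNReal.rpow_mul, ← ENNReal.rpow_mul,
      mul_comm]
    congr 1
    · congr 1; field_simp
    · rw [show 2 / p * (p / 2) = 1 by field_simp, ENNReal.rpow_one]
  calc ∫⁻ x, (∫⁻ y, k y ^ 2 * ∏ j, g j (x - θ j • y) ^ 2 ∂μ) ^ (p / 2) ∂μ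
      ≤ ∫⁻ x, N ^ (p / 2 - 1) * ∫⁻ y, k y ^ 2 * ∏ j, g j (x - θ j • y) ^ p ∂μ ∂μ :=
        lintegral_mono hjensen
    _ = N ^ (p / 2 - 1) * ∫⁻ y, k y ^ 2 * ∫⁻ x, ∏ j, g j (x - θ j • y) ^ p ∂μ ∂μ := by
        rw [lintegral_const_mul _ hm.lintegral_prod_right', lintegral_lintegral_swap]
        · congr 2 with y
          dsimp only
          rw [lintegral_const_mul _ (by fun_prop)]
        · exact hm.aemeasurable
    _ ≤ N ^ (p / 2 - 1) * ∫⁻ y, k y ^ 2 * ∏ j, (∫⁻ x, g j x ^ q j ∂μ) ^ (p / q j) ∂μ := by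
        gcongr with y
        have h := ENNReal.lintegral_prod_norm_pow_le (μ := μ) Finset.univ
          (f := fun j x => g j (x - θ j • y) ^ q j) (fun j _ => by have := hg j; fun_prop)
          hsum fun j _ => hpq j
        simp_rw [fun j => lintegral_sub_right_eq_self (μ := μ) (fun x => g j x ^ q j) (θ j • y)]
          at h
        refine le_trans (le_of_eq ?_) h
        refine lintegral_congr fun x => Finset.prod_congr rfl fun j _ => ?_
        rw [← ENNReal.rpow_mul, mul_div_cancel₀ _ (hq j).ne']
    _ = _ := by
        rw [lintegral_mul_const _ (by fun_prop), ← mul_assoc]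
        congr 1
        rw [← hN]
        nth_rw 2 [← ENNReal.rpow_one N]
        rw [← ENNReal.rpow_add_of_nonneg _ _ hpp zero_le_one, sub_add_cancel]

end Core

/-! ### Bessel's inequality and orthogonality of exponentials -/

/-- Bessel's inequality for an orthonormal family of unimodular functions, with no integrability
assumption. -/
theorem tsum_enorm_integral_mul_sq_le {α κ : Type*} [MeasurableSpace α] {μ : Measure α}
    [IsFiniteMeasure μ] {e : κ → α → ℂ} (he : ∀ i, AEStronglyMeasurable (e i) μ)
    (hnorm : ∀ i a, ‖e i a‖ = 1)
    (horth : ∀ i j, i ≠ j → ∫ a, e i a * (starRingEnd ℂ) (e j a) ∂μ = 0) (hμ : μ Set.univ = 1)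
    {G : α → ℂ} (hG : AEStronglyMeasurable G μ) :
    ∑' i, ‖∫ a, G a * e i a ∂μ‖ₑ ^ 2 ≤ ∫⁻ a, ‖G a‖ₑ ^ 2 ∂μ := by
  classical
  by_cases htop : ∫⁻ a, ‖G a‖ₑ ^ 2 ∂μ = ∞
  · simp [htop]
  have hnormG : eLpNorm G 2 μ ^ 2 = ∫⁻ a, ‖G a‖ₑ ^ 2 ∂μ := by
    have := eLpNorm_nnreal_pow_eq_lintegral (μ := μ) (f := G) (p := 2) two_ne_zero
    simpa using this
  have hGm : MemLp G 2 μ := by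
    refine ⟨hG, lt_top_iff_ne_top.2 fun h => htop ?_⟩
    rw [← hnormG, h]; simp
  -- The inner product is conjugate-linear in its first slot, so the conjugates of `e i` produce
  -- integrals against `e i` itself.
  have hem : ∀ i, MemLp (fun a => (starRingEnd ℂ) (e i a)) 2 μ := fun i =>
    MemLp.of_bound (Complex.continuous_conj.comp_aestronglyMeasurable (he i)) 1
      (Filter.Eventually.of_forall fun a => by simp [hnorm])
  have hself : ∀ i a, e i a * (starRingEnd ℂ) (e i a) = 1 := by
    intro i a; rw [Complex.mul_conj, Complex.normSq_eq_norm_sq, hnorm]; simp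
  have hinner : ∀ i (F : α → ℂ) (hF : MemLp F 2 μ),
      inner ℂ ((hem i).toLp _) (hF.toLp F) = ∫ a, F a * e i a ∂μ := by
    intro i F hF
    rw [L2.inner_def]
    refine integral_congr_ae ?_
    filter_upwards [(hem i).coeFn_toLp, hF.coeFn_toLp] with a h1 h2
    rw [h1, h2]; simp
  have hv : Orthonormal ℂ fun i => (hem i).toLp _ := by
    rw [orthonormal_iff_ite]
    intro i j
    rw [hinner]
    split_ifs with h
    · subst h
      simp_rw [mul_comm _ (e i _), hself]
      simp [Measure.real, hμ]
    · simp_rw [mul_comm _ (e i _)]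
      exact horth i j h
  rw [ENNReal.tsum_eq_iSup_sum]
  refine iSup_le fun s => ?_
  have h := hv.sum_inner_products_le (hGm.toLp G) (s := s)
  simp_rw [hinner, Lp.norm_toLp] at h
  rw [← hnormG]
  calc ∑ i ∈ s, ‖∫ a, G a * e i a ∂μ‖ₑ ^ 2
      = ENNReal.ofReal (∑ i ∈ s, ‖∫ a, G a * e i a ∂μ‖ ^ 2) := by
        rw [ENNReal.ofReal_sum_of_nonneg fun _ _ => by positivity]
        refine Finset.sum_congr rfl fun i _ => ?_
        rw [ENNReal.ofReal_pow (norm_nonneg _), ofReal_norm]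
    _ ≤ ENNReal.ofReal ((eLpNorm G 2 μ).toReal ^ 2) := ENNReal.ofReal_le_ofReal h
    _ = eLpNorm G 2 μ ^ 2 := by
        rw [ENNReal.ofReal_pow ENNReal.toReal_nonneg, ENNReal.ofReal_toReal hGm.2.ne]

theorem setIntegral_Ico_exp_two_pi_mul_int (a : ℤ) {n : ℤ} (hn : n ≠ 0) :
    ∫ t in Set.Ico (a : ℝ) (a + 1), Complex.exp (2 * Real.pi * Complex.I * (n * t : ℝ)) = 0 := by
  rw [integral_Ico_eq_integral_Ioc, ← intervalIntegral.integral_of_le (by linarith)]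
  have hc : 2 * Real.pi * Complex.I * n ≠ 0 := by
    simp [Complex.I_ne_zero, Real.pi_ne_zero, hn]
  have h := integral_exp_mul_complex (a := (a : ℝ)) (b := (a + 1 : ℝ)) hc
  have h1 : ∀ t : ℝ, Complex.exp (2 * Real.pi * Complex.I * (n * t : ℝ)) =
      Complex.exp (2 * Real.pi * Complex.I * n * t) := by
    intro t; congr 1; push_cast; ring
  simp_rw [h1]
  rw [h]
  have h2 : ∀ z : ℤ, Complex.exp (2 * Real.pi * Complex.I * n * z) = 1 := by
    intro z
    rw [Complex.exp_eq_one_iff]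
    exact ⟨n * z, by push_cast; ring⟩
  have h3 := h2 (a + 1)
  have h4 := h2 a
  push_cast at h3 h4 ⊢
  rw [h3, h4]; simp

/-! ### Unit cubes and characters -/

namespace SquareFunction

variable {d : ℕ}

theorem cube_eq_preimage (u : Fin d → ℤ) :
    cube u = WithLp.ofLp ⁻¹' (Set.univ.pi fun i => Set.Ico (u i : ℝ) (u i + 1)) := by
  ext x; simp [cube]

theorem measurableSet_cube (u : Fin d → ℤ) : MeasurableSet (cube u) := by
  rw [cube_eq_preimage]
  exact (PiLp.volume_preserving_ofLp (Fin d)).measurable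
    (MeasurableSet.univ_pi fun i => measurableSet_Ico)

theorem volume_cube (u : Fin d → ℤ) : volume (cube u) = 1 := by
  rw [cube_eq_preimage, (PiLp.volume_preserving_ofLp (Fin d)).measure_preimage
    (MeasurableSet.univ_pi fun i => measurableSet_Ico).nullMeasurableSet, volume_pi_pi]
  simp

theorem iUnion_cube : ⋃ u : Fin d → ℤ, cube u = Set.univ := by
  refine Set.eq_univ_of_forall fun x => Set.mem_iUnion.2 ⟨fun i => ⌊x i⌋, fun i => ?_⟩
  exact ⟨Int.floor_le _, Int.lt_floor_add_one _⟩

theorem pairwise_disjoint_cube :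
    Pairwise (Function.onFun Disjoint (cube : (Fin d → ℤ) → Set (EuclideanSpace ℝ (Fin d)))) := by
  intro u v huv
  refine Set.disjoint_left.2 fun x hu hv => huv (funext fun i => ?_)
  rw [← Int.floor_eq_iff.2 (hu i), ← Int.floor_eq_iff.2 (hv i)]

theorem cube_subset_ball (u : Fin d → ℤ) :
    cube u ⊆ Metric.ball (WithLp.toLp 2 fun i => (u i : ℝ)) (d + 1) := by
  intro x hx
  rw [Metric.mem_ball, EuclideanSpace.dist_eq]
  have h : ∑ i, dist (x i) (u i : ℝ) ^ 2 ≤ d := by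
    calc ∑ i, dist (x i) (u i : ℝ) ^ 2 ≤ ∑ _i : Fin d, (1 : ℝ) := by
          refine Finset.sum_le_sum fun i _ => ?_
          rw [Real.dist_eq, sq_abs]
          nlinarith [hx i]
      _ = d := by simp
  rw [Real.sqrt_lt' (by positivity)]
  have : (0 : ℝ) ≤ d := d.cast_nonneg
  refine h.trans_lt ?_
  nlinarith

/-- The character `y ↦ e^{2 π i ℓ · y}`. -/
noncomputable def character (l : Fin d → ℤ) (y : EuclideanSpace ℝ (Fin d)) : ℂ :=
  Complex.exp (2 * Real.pi * Complex.I * ((∑ i, (l i : ℝ) * y i : ℝ) : ℂ))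

theorem modulatedKernel_eq (K : EuclideanSpace ℝ (Fin d) → ℂ) (l : Fin d → ℤ) :
    modulatedKernel K l = fun y => K y * character l y := rfl

theorem norm_character (l : Fin d → ℤ) (y : EuclideanSpace ℝ (Fin d)) : ‖character l y‖ = 1 := by
  rw [character, mul_right_comm, ← Complex.ofReal_ofNat, ← Complex.ofReal_mul,
    ← Complex.ofReal_mul, Complex.norm_exp_ofReal_mul_I]

theorem continuous_character (l : Fin d → ℤ) : Continuous (character l) := by
  unfold character; fun_prop

theorem character_mul_conj (l l' : Fin d → ℤ) (y : EuclideanSpace ℝ (Fin d)) :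
    character l y * (starRingEnd ℂ) (character l' y) =
      ∏ i, Complex.exp (2 * Real.pi * Complex.I * (((l i - l' i : ℤ) : ℝ) * y i : ℝ)) := by
  rw [← Complex.exp_sum, character, character, ← Complex.exp_conj, ← Complex.exp_add]
  congr 1
  simp only [map_mul, Complex.conj_I, Complex.conj_ofReal, map_ofNat]
  rw [← Finset.mul_sum, mul_neg, neg_mul, ← sub_eq_add_neg, ← mul_sub]
  congr 1
  push_cast
  rw [← Finset.sum_sub_distrib]
  exact Finset.sum_congr rfl fun i _ => by ring

theorem setIntegral_cube_character_mul_conj (u : Fin d → ℤ) {l l' : Fin d → ℤ} (h : l ≠ l') :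
    ∫ y in cube u, character l y * (starRingEnd ℂ) (character l' y) = 0 := by
  simp_rw [character_mul_conj]
  rw [cube_eq_preimage]
  have hp := (PiLp.volume_preserving_ofLp (Fin d)).setIntegral_preimage_emb
    (MeasurableEquiv.toLp 2 (Fin d → ℝ)).symm.measurableEmbedding
    (fun w : Fin d → ℝ => ∏ i, Complex.exp (2 * Real.pi * Complex.I *
      (((l i - l' i : ℤ) : ℝ) * w i : ℝ))) (Set.univ.pi fun i => Set.Ico (u i : ℝ) (u i + 1))
  refine hp.trans ?_
  rw [volume_pi, Measure.restrict_pi_pi,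
    integral_fintype_prod_eq_prod (fun (i : Fin d) (t : ℝ) => Complex.exp (2 * Real.pi * Complex.I *
      (((l i - l' i : ℤ) : ℝ) * t : ℝ)))]
  obtain ⟨i, hi⟩ := Function.ne_iff.1 h
  exact Finset.prod_eq_zero (Finset.mem_univ i)
    (setIntegral_Ico_exp_two_pi_mul_int (u i) (sub_ne_zero.2 hi))

/-- Bessel's inequality on a unit cube. -/
theorem tsum_enorm_setIntegral_cube_sq_le (u : Fin d → ℤ) {G : EuclideanSpace ℝ (Fin d) → ℂ}
    (hG : AEStronglyMeasurable G volume) :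
    ∑' l, ‖∫ y in cube u, G y * character l y‖ₑ ^ 2 ≤ ∫⁻ y in cube u, ‖G y‖ₑ ^ 2 := by
  have huniv : (volume.restrict (cube u)) Set.univ = 1 := by simp [volume_cube]
  have : IsFiniteMeasure (volume.restrict (cube u)) := ⟨by simp [huniv]⟩
  exact tsum_enorm_integral_mul_sq_le (fun l => (continuous_character l).aestronglyMeasurable)
    norm_character (fun l l' h => setIntegral_cube_character_mul_conj u h) huniv hG.restrict

/-- Summing Bessel's inequality over all cubes: the `ℓ²` norm of the Fourier-type coefficients of
`G` is controlled by the amalgam norm `ℓ¹(L²)` of `G`. -/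
theorem tsum_enorm_integral_character_sq_le {G : EuclideanSpace ℝ (Fin d) → ℂ}
    (hG : Integrable G volume) :
    (∑' l, ‖∫ y, G y * character l y‖ₑ ^ 2) ^ (1 / 2 : ℝ) ≤
      ∑' u, (∫⁻ y in cube u, ‖G y‖ₑ ^ 2) ^ (1 / 2 : ℝ) := by
  have hint : ∀ l, Integrable (fun y => G y * character l y) volume := fun l =>
    hG.mul_bdd (continuous_character l).aestronglyMeasurable
      (Filter.Eventually.of_forall fun y => (norm_character l y).le)
  have hsplit : ∀ l, ‖∫ y, G y * character l y‖ₑ ≤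
      ∑' u, ‖∫ y in cube u, G y * character l y‖ₑ := by
    intro l
    rw [← setIntegral_univ, ← iUnion_cube, integral_iUnion measurableSet_cube
      pairwise_disjoint_cube (hint l).integrableOn]
    exact enorm_tsum_le_tsum_enorm
  calc (∑' l, ‖∫ y, G y * character l y‖ₑ ^ 2) ^ (1 / 2 : ℝ)
      ≤ (∑' l, (∑' u, ‖∫ y in cube u, G y * character l y‖ₑ) ^ (2 : ℝ)) ^ (1 / 2 : ℝ) := by
        simp_rw [ENNReal.rpow_two]
        gcongr with l
        exact hsplit l
    _ ≤ ∑' u, (∑' l, ‖∫ y in cube u, G y * character l y‖ₑ ^ (2 : ℝ)) ^ (1 / 2 : ℝ) :=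
        tsum_tsum_rpow_le _ one_le_two
    _ ≤ _ := by
        simp_rw [ENNReal.rpow_two]
        gcongr with u
        exact tsum_enorm_setIntegral_cube_sq_le u hG.1

/-- Cauchy–Schwarz on each cube, whose volume is 1. Finiteness of the right side is what later gives
absolute convergence. -/
theorem lintegral_enorm_le_tsum_cube {G : EuclideanSpace ℝ (Fin d) → ℂ}
    (hG : AEStronglyMeasurable G volume) :
    ∫⁻ y, ‖G y‖ₑ ≤ ∑' u, (∫⁻ y in cube u, ‖G y‖ₑ ^ 2) ^ (1 / 2 : ℝ) := by
  rw [← setLIntegral_univ, ← iUnion_cube, lintegral_iUnion measurableSet_cube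
    pairwise_disjoint_cube]
  gcongr with u
  have h := ENNReal.lintegral_mul_norm_pow_le (μ := volume.restrict (cube u))
    (f := fun y => ‖G y‖ₑ ^ 2) (g := fun _ => 1) (hG.restrict.enorm.pow_const 2)
    aemeasurable_const (p := 1 / 2) (q := 1 / 2) (by norm_num) (by norm_num) (by norm_num)
  have hsq : ∀ a : ℝ≥0∞, (a ^ 2) ^ (1 / 2 : ℝ) = a := by
    intro a; rw [← ENNReal.rpow_two, ← ENNReal.rpow_mul]; simp
  simp only [hsq] at h
  simpa [volume_cube] using h

end SquareFunction

/-! ### The bound on one cube and summation over cubes -/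

namespace SquareFunction

variable {d m : ℕ}

theorem two_div_conjExponent_toReal {p : ℝ≥0∞} (hp1 : 1 < p) (hp2 : p < 2) :
    2 ≤ p.conjExponent.toReal ∧ p.conjExponent ≠ ∞ ∧
      2 / p.conjExponent.toReal + 2 / p.toReal = 2 := by
  have hptop : p ≠ ∞ := (hp2.trans ENNReal.ofNat_lt_top).ne
  have hP1 : 1 < p.toReal := by
    simpa using (ENNReal.toReal_lt_toReal ENNReal.one_ne_top hptop).2 hp1
  have hP2 : p.toReal < 2 := by
    simpa using (ENNReal.toReal_lt_toReal hptop ENNReal.ofNat_ne_top).2 hp2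
  have hne : p - 1 ≠ 0 := (tsub_pos_of_lt hp1).ne'
  have htop : p.conjExponent ≠ ∞ := by
    simp [ENNReal.conjExponent, hne]
  have hr : p.conjExponent.toReal = 1 + (p.toReal - 1)⁻¹ := by
    rw [ENNReal.conjExponent, ENNReal.toReal_add ENNReal.one_ne_top (by simp [hne]),
      ENNReal.toReal_inv, ENNReal.toReal_sub_of_le hp1.le hptop]
    simp
  have hpos : 0 < p.toReal - 1 := by linarith
  refine ⟨?_, htop, ?_⟩
  · rw [hr]
    have : 1 ≤ (p.toReal - 1)⁻¹ := (one_le_inv₀ hpos).2 (by linarith)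
    linarith
  · rw [hr]
    field_simp
    ring

theorem eLpNorm_sq_eq {α ε : Type*} [MeasurableSpace α] [TopologicalSpace ε] [ContinuousENorm ε]
    {μ : Measure α} {r : ℝ≥0∞} (h0 : r ≠ 0) (htop : r ≠ ∞) (f : α → ε) :
    eLpNorm f r μ ^ 2 = (∫⁻ x, ‖f x‖ₑ ^ r.toReal ∂μ) ^ (2 / r.toReal) := by
  rw [eLpNorm_eq_lintegral_rpow_enorm_toReal h0 htop, ← ENNReal.rpow_two, ← ENNReal.rpow_mul]
  congr 1
  ring

/-- The product-space `L²` bound with a kernel in `L^{p'}`, `1 ≤ p < 2`. -/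
theorem lintegral_kernel_mul_prod_shear_sq_le {θ : Fin m → ℝ} (hθ : Function.Injective θ)
    {p : ℝ≥0∞} (hp1 : 1 ≤ p) (hp2 : p < 2) {q : Fin m → ℝ} (hq : ∀ j, 2 ≤ q j)
    (hsum : ∑ j, 2 / q j = 2 / p.toReal)
    {k : EuclideanSpace ℝ (Fin d) → ℂ} (hk : Measurable k)
    {g : Fin m → EuclideanSpace ℝ (Fin d) → ℝ≥0∞} (hg : ∀ j, Measurable (g j)) :
    ∫⁻ z, ‖k z.2‖ₑ ^ 2 * ∏ j, g j (z.1 - θ j • z.2) ^ 2 ∂(volume.prod volume) ≤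
      shearConst (EuclideanSpace ℝ (Fin d)) θ * eLpNorm k p.conjExponent volume ^ 2 *
        ∏ j, (∫⁻ x, g j x ^ q j) ^ (2 / q j) := by
  -- At `p = 1` the kernel exponent is `∞`; the sup norm is pulled out and the `2 / q j` alone
  -- already sum to 2.
  rcases hp1.eq_or_lt with rfl | hp1
  · have htop : ENNReal.conjExponent 1 = ∞ := by simp [ENNReal.conjExponent]
    rw [htop]
    have hae : ∀ᵐ z ∂((volume : Measure (EuclideanSpace ℝ (Fin d))).prod
        (volume : Measure (EuclideanSpace ℝ (Fin d)))), ‖k z.2‖ₑ ≤ eLpNorm k ∞ volume := by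
      rw [eLpNorm_exponent_top]
      exact Measure.quasiMeasurePreserving_snd.ae (enorm_ae_le_eLpNormEssSup k volume)
    calc ∫⁻ z, ‖k z.2‖ₑ ^ 2 * ∏ j, g j (z.1 - θ j • z.2) ^ 2 ∂(volume.prod volume)
        ≤ ∫⁻ z, eLpNorm k ∞ volume ^ 2 * ∏ j, g j (z.1 - θ j • z.2) ^ 2
            ∂((volume : Measure (EuclideanSpace ℝ (Fin d))).prod volume) := by
          refine lintegral_mono_ae ?_
          filter_upwards [hae] with z hz
          gcongr
      _ ≤ eLpNorm k ∞ volume ^ 2 * (shearConst (EuclideanSpace ℝ (Fin d)) θ *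
            ∏ j, (∫⁻ x, g j x ^ q j) ^ (2 / q j)) := by
          rw [lintegral_const_mul _ (by fun_prop)]
          gcongr
          exact lintegral_prod_shear_sq_le volume hθ hq (by simpa using hsum) hg
      _ = _ := by ring
  · obtain ⟨hr2, hrtop, hrsum⟩ := two_div_conjExponent_toReal hp1 hp2
    have hr0 : p.conjExponent ≠ 0 := by
      rintro h; rw [h] at hr2; norm_num at hr2
    rw [eLpNorm_sq_eq hr0 hrtop, mul_assoc]
    exact lintegral_snd_mul_prod_shear_sq_le volume hθ hq hr2 (by rw [hsum, hrsum]) hk.enorm hg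

/-- The `L^p` bound for the square function of a kernel supported in a unit cube. -/
theorem exists_lintegral_cube_rpow_le {θ : Fin m → ℝ} (hθ : Function.Injective θ)
    {p : ℝ≥0∞} (hp1 : 1 ≤ p) (hp : p < ∞) {q : Fin m → ℝ} (hq : ∀ j, 2 ≤ q j)
    (hsum : ∑ j, p.toReal / q j = 1) :
    ∃ C : ℝ≥0∞, C < ∞ ∧ ∀ (u : Fin d → ℤ) (K : EuclideanSpace ℝ (Fin d) → ℂ), Measurable K →
      ∀ g : Fin m → EuclideanSpace ℝ (Fin d) → ℝ≥0∞, (∀ j, Measurable (g j)) →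
        ∫⁻ x, (∫⁻ y, ‖(cube u).indicator K y‖ₑ ^ 2 *
            ∏ j, g j (x - θ j • y) ^ 2) ^ (p.toReal / 2) ≤
          C * eLpNorm ((cube u).indicator K) (kernelExponent p) volume ^ p.toReal *
            ∏ j, (∫⁻ x, g j x ^ q j) ^ (p.toReal / q j) := by
  have hq0 : ∀ j, 0 < q j := fun j => by linarith [hq j]
  have hP1 : 1 ≤ p.toReal := by
    simpa using (ENNReal.toReal_le_toReal ENNReal.one_ne_top hp.ne).2 hp1
  have hP0 : 0 < p.toReal := by linarith
  by_cases hp2 : p < 2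
  · have hP2 : p.toReal ≤ 2 := by
      simpa using (ENNReal.toReal_le_toReal hp.ne ENNReal.ofNat_ne_top).2 hp2.le
    have hsum2 : ∑ j, 2 / q j = 2 / p.toReal := by
      rw [eq_div_iff hP0.ne']
      calc (∑ j, 2 / q j) * p.toReal = 2 * ∑ j, p.toReal / q j := by
            rw [Finset.sum_mul, Finset.mul_sum]
            exact Finset.sum_congr rfl fun j _ => by ring
        _ = 2 := by rw [hsum, mul_one]
    set D := ((volume (Metric.ball (0 : EuclideanSpace ℝ (Fin d)) 1))⁻¹ *
      volume (Metric.ball (0 : EuclideanSpace ℝ (Fin d)) 1) ^ (1 - p.toReal / 2) *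
        ∏ j, volume (Metric.ball (0 : EuclideanSpace ℝ (Fin d)) (1 + |θ j| * (d + 1))) ^
          (p.toReal / q j)) with hD
    have hDtop : D < ∞ := by
      refine ENNReal.mul_lt_top (ENNReal.mul_lt_top ?_ ?_) (ENNReal.prod_lt_top fun j _ => ?_)
      · exact ENNReal.inv_lt_top.2 (Metric.measure_ball_pos volume _ one_pos)
      · exact ENNReal.rpow_lt_top_of_nonneg (by linarith) measure_ball_lt_top.ne
      · exact ENNReal.rpow_lt_top_of_nonneg (div_pos hP0 (hq0 j)).le measure_ball_lt_top.ne
    refine ⟨D * shearConst (EuclideanSpace ℝ (Fin d)) θ ^ (p.toReal / 2),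
      ENNReal.mul_lt_top hDtop (ENNReal.rpow_lt_top_of_nonneg (by positivity)
        (shearConst_lt_top θ).ne), fun u K hK g hg => ?_⟩
    have hKu : Measurable ((cube u).indicator K) := hK.indicator (measurableSet_cube u)
    have h := lintegral_rpow_shear_le_of_local volume hq0 hP0 hP2 hsum hKu.enorm
      (c := WithLp.toLp 2 fun i => (u i : ℝ)) (ρ := d + 1)
      (fun y hy => cube_subset_ball u (by
        by_contra hyu
        exact hy (by simp [hyu])))
      (fun g hg => lintegral_kernel_mul_prod_shear_sq_le hθ hp1 hp2 hq hsum2 hKu hg) hg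
    refine h.trans_eq ?_
    rw [ENNReal.mul_rpow_of_nonneg _ _ (by positivity), ← ENNReal.rpow_two, ← ENNReal.rpow_mul,
      mul_div_cancel₀ _ two_ne_zero, kernelExponent, if_pos hp2]
    ring
  -- For `p ≥ 2` neither the Jensen nor the Hölder step costs a constant, and the support of the
  -- kernel plays no role.
  · refine ⟨1, ENNReal.one_lt_top, fun u K hK g hg => ?_⟩
    have hP2 : 2 ≤ p.toReal := by
      simpa using (ENNReal.toReal_le_toReal ENNReal.ofNat_ne_top hp.ne).2 (not_lt.1 hp2)
    have hKu : Measurable ((cube u).indicator K) := hK.indicator (measurableSet_cube u)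
    refine (lintegral_rpow_shear_le_of_two_le volume θ hq0 hP2 hsum hKu.enorm hg).trans_eq ?_
    rw [kernelExponent, if_neg hp2, one_mul,
      eLpNorm_eq_lintegral_rpow_enorm_toReal two_ne_zero ENNReal.ofNat_ne_top,
      ← ENNReal.rpow_mul]
    simp [div_eq_inv_mul]

/-- The square function over one cube. -/
noncomputable def cubeSquare (θ : Fin m → ℝ) (K : EuclideanSpace ℝ (Fin d) → ℂ)
    (f : Fin m → EuclideanSpace ℝ (Fin d) → ℂ) (u : Fin d → ℤ)
    (x : EuclideanSpace ℝ (Fin d)) : ℝ≥0∞ :=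
  (∫⁻ y in cube u, ‖multilinearIntegrand θ K f x y‖ₑ ^ 2) ^ (1 / 2 : ℝ)

theorem multilinearIntegrand_modulatedKernel (θ : Fin m → ℝ) (K : EuclideanSpace ℝ (Fin d) → ℂ)
    (l : Fin d → ℤ) (f : Fin m → EuclideanSpace ℝ (Fin d) → ℂ) (x y : EuclideanSpace ℝ (Fin d)) :
    multilinearIntegrand θ (modulatedKernel K l) f x y =
      multilinearIntegrand θ K f x y * character l y := by
  rw [modulatedKernel_eq, multilinearIntegrand, multilinearIntegrand, mul_assoc]

theorem measurable_multilinearIntegrand (θ : Fin m → ℝ) {K : EuclideanSpace ℝ (Fin d) → ℂ}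
    (hK : Measurable K) {f : Fin m → EuclideanSpace ℝ (Fin d) → ℂ} (hf : ∀ j, Measurable (f j)) :
    Measurable fun z : EuclideanSpace ℝ (Fin d) × EuclideanSpace ℝ (Fin d) =>
      multilinearIntegrand θ K f z.1 z.2 := by
  unfold multilinearIntegrand
  fun_prop

theorem cubeSquare_eq (θ : Fin m → ℝ) (K : EuclideanSpace ℝ (Fin d) → ℂ)
    (f : Fin m → EuclideanSpace ℝ (Fin d) → ℂ) (u : Fin d → ℤ) (x : EuclideanSpace ℝ (Fin d)) :
    cubeSquare θ K f u x =
      (∫⁻ y, ‖(cube u).indicator K y‖ₑ ^ 2 * ∏ j, ‖f j (x - θ j • y)‖ₑ ^ 2) ^ (1 / 2 : ℝ) := by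
  rw [cubeSquare, ← lintegral_indicator (measurableSet_cube u)]
  congr 2 with y
  by_cases hy : y ∈ cube u
  · rw [Set.indicator_of_mem hy, Set.indicator_of_mem hy, multilinearIntegrand, enorm_mul,
      mul_pow, mul_comm, Finset.prod_pow]
    congr 2
    simp [enorm_eq_nnnorm, nnnorm_prod]
  · simp [hy]

theorem measurable_cubeSquare (θ : Fin m → ℝ) {K : EuclideanSpace ℝ (Fin d) → ℂ}
    (hK : Measurable K) {f : Fin m → EuclideanSpace ℝ (Fin d) → ℂ} (hf : ∀ j, Measurable (f j))
    (u : Fin d → ℤ) : Measurable (cubeSquare θ K f u) :=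
  ((measurable_multilinearIntegrand θ hK hf).enorm.pow_const 2).lintegral_prod_right'.pow_const _

theorem measurable_squareFunction (θ : Fin m → ℝ) {K : EuclideanSpace ℝ (Fin d) → ℂ}
    (hK : Measurable K) {f : Fin m → EuclideanSpace ℝ (Fin d) → ℂ} (hf : ∀ j, Measurable (f j)) :
    Measurable (squareFunction θ K f) := by
  have hl : ∀ l, Measurable (modulatedKernel K l) := fun l => by
    rw [modulatedKernel_eq]; exact hK.mul (continuous_character l).measurable
  have hp : ∀ l, Measurable (pieceOp θ K l f) := fun l =>
    (measurable_multilinearIntegrand θ (hl l) hf).stronglyMeasurable.integral_prod_right'.measurable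
  exact (Measurable.tsum fun l => (hp l).enorm.pow_const 2).pow_const _

theorem squareFunction_le_tsum_cubeSquare {θ : Fin m → ℝ} {K : EuclideanSpace ℝ (Fin d) → ℂ}
    {f : Fin m → EuclideanSpace ℝ (Fin d) → ℂ} {x : EuclideanSpace ℝ (Fin d)}
    (h : Integrable (multilinearIntegrand θ K f x) volume) :
    squareFunction θ K f x ≤ ∑' u, cubeSquare θ K f u x := by
  simp only [squareFunction, pieceOp, multilinearIntegrand_modulatedKernel]
  exact tsum_enorm_integral_character_sq_le h

theorem integrable_multilinearIntegrand {θ : Fin m → ℝ} {K : EuclideanSpace ℝ (Fin d) → ℂ}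
    (hK : Measurable K) {f : Fin m → EuclideanSpace ℝ (Fin d) → ℂ} (hf : ∀ j, Measurable (f j))
    {x : EuclideanSpace ℝ (Fin d)} (h : ∑' u, cubeSquare θ K f u x < ∞) :
    Integrable (multilinearIntegrand θ K f x) volume := by
  have hm : AEStronglyMeasurable (multilinearIntegrand θ K f x) volume :=
    ((measurable_multilinearIntegrand θ hK hf).comp measurable_prodMk_left).aestronglyMeasurable
  exact ⟨hm, (lintegral_enorm_le_tsum_cube hm).trans_lt h⟩

/-- Minkowski in `L^p` turns the bound uniform in `u` into a sum of local kernel norms, which is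
exactly `kernelConst`. -/
theorem exists_lintegral_tsum_cubeSquare_le {θ : Fin m → ℝ} (hθ : Function.Injective θ)
    {p : ℝ≥0∞} (hp1 : 1 ≤ p) (hp : p < ∞) {q : Fin m → ℝ≥0∞} (hq2 : ∀ j, 2 ≤ q j)
    (hq : ∀ j, q j < ∞) (hpq : 1 / p = ∑ j, 1 / q j) :
    ∃ C : ℝ≥0∞, C < ∞ ∧ ∀ K : EuclideanSpace ℝ (Fin d) → ℂ, Measurable K →
      ∀ f : Fin m → EuclideanSpace ℝ (Fin d) → ℂ, (∀ j, Measurable (f j)) →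
        (∫⁻ x, (∑' u, cubeSquare θ K f u x) ^ p.toReal) ^ (1 / p.toReal) ≤
          C * kernelConst p K * ∏ j, eLpNorm (f j) (q j) volume := by
  have hP1 : 1 ≤ p.toReal := by
    simpa using (ENNReal.toReal_le_toReal ENNReal.one_ne_top hp.ne).2 hp1
  have hP0 : 0 < p.toReal := by linarith
  have hQ2 : ∀ j, 2 ≤ (q j).toReal := fun j => by
    simpa using (ENNReal.toReal_le_toReal ENNReal.ofNat_ne_top (hq j).ne).2 (hq2 j)
  have hq0 : ∀ j, q j ≠ 0 := fun j => (lt_of_lt_of_le two_pos (hq2 j)).ne'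
  have hsum : ∑ j, p.toReal / (q j).toReal = 1 := by
    have h := congrArg ENNReal.toReal hpq
    rw [ENNReal.toReal_sum fun j _ => by simp [hq0 j]] at h
    simp only [one_div, ENNReal.toReal_inv] at h
    simp only [div_eq_mul_inv]
    rw [← Finset.mul_sum, ← h, mul_inv_cancel₀ hP0.ne']
  obtain ⟨C, hC, hbound⟩ := exists_lintegral_cube_rpow_le (d := d) hθ hp1 hp hQ2 hsum
  refine ⟨C ^ (1 / p.toReal), ENNReal.rpow_lt_top_of_nonneg (by positivity) hC.ne,
    fun K hK f hf => ?_⟩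
  refine (lintegral_tsum_rpow_le
    (fun u => (measurable_cubeSquare θ hK hf u).aemeasurable) hP1).trans ?_
  rw [kernelConst, ← ENNReal.tsum_mul_left, ← ENNReal.tsum_mul_right]
  refine ENNReal.tsum_le_tsum fun u => ?_
  have h := hbound u K hK (fun j x => ‖f j x‖ₑ) fun j => (hf j).enorm
  have hrw : ∀ x, cubeSquare θ K f u x ^ p.toReal =
      (∫⁻ y, ‖(cube u).indicator K y‖ₑ ^ 2 *
        ∏ j, ‖f j (x - θ j • y)‖ₑ ^ 2) ^ (p.toReal / 2) := by
    intro x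
    rw [cubeSquare_eq, ← ENNReal.rpow_mul]
    congr 1
    ring
  simp_rw [hrw]
  refine (ENNReal.rpow_le_rpow h (by positivity)).trans_eq ?_
  rw [ENNReal.mul_rpow_of_nonneg _ _ (by positivity), ENNReal.mul_rpow_of_nonneg _ _ (by positivity),
    ← ENNReal.rpow_mul, mul_one_div_cancel hP0.ne', ENNReal.rpow_one,
    ← ENNReal.prod_rpow_of_nonneg (by positivity)]
  congr 1
  refine Finset.prod_congr rfl fun j _ => ?_
  rw [eLpNorm_eq_lintegral_rpow_enorm_toReal (hq0 j) (hq j).ne, ← ENNReal.rpow_mul]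
  congr 1
  field_simp

/-! ### Independence of representatives -/

/-- Changing the functions and the kernel on null sets changes the integrand, for every `x`, only
on a null set of `y`. -/
theorem multilinearIntegrand_congr_ae {θ : Fin m → ℝ} (hθ0 : ∀ j, θ j ≠ 0)
    {K K' : EuclideanSpace ℝ (Fin d) → ℂ} (hK : K =ᵐ[volume] K')
    {f f' : Fin m → EuclideanSpace ℝ (Fin d) → ℂ} (hf : ∀ j, f j =ᵐ[volume] f' j)
    (l : Fin d → ℤ) (x : EuclideanSpace ℝ (Fin d)) :
    multilinearIntegrand θ (modulatedKernel K l) f x =ᵐ[volume]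
      multilinearIntegrand θ (modulatedKernel K' l) f' x := by
  have hj : ∀ j, ∀ᵐ y ∂(volume : Measure (EuclideanSpace ℝ (Fin d))),
      f j (x - θ j • y) = f' j (x - θ j • y) := by
    intro j
    have hsub : Measure.QuasiMeasurePreserving (fun y : EuclideanSpace ℝ (Fin d) => x - y)
        volume volume := (Measure.measurePreserving_sub_left volume x).quasiMeasurePreserving
    have hsmul : Measure.QuasiMeasurePreserving (fun y : EuclideanSpace ℝ (Fin d) => θ j • y)
        volume volume := by
      refine ⟨measurable_const_smul _, ?_⟩
      erw [Measure.map_addHaar_smul volume (hθ0 j)]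
      exact Measure.smul_absolutelyContinuous
    exact (hsub.comp hsmul).ae (hf j)
  filter_upwards [hK, ae_all_iff.2 hj] with y hy hfy
  simp only [multilinearIntegrand, modulatedKernel, hy, hfy]

theorem kernelConst_congr_ae (p : ℝ≥0∞) {K K' : EuclideanSpace ℝ (Fin d) → ℂ}
    (hK : K =ᵐ[volume] K') : kernelConst p K = kernelConst p K' := by
  refine tsum_congr fun u => eLpNorm_congr_ae ?_
  filter_upwards [hK] with y hy
  simp only [Set.indicator, hy]

/-- Equality holds at every `x`: since `θ j ≠ 0`, the map `y ↦ x - θ j • y` pulls null sets back to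
null sets for each fixed `x`. -/
theorem squareFunction_congr_ae {θ : Fin m → ℝ} (hθ0 : ∀ j, θ j ≠ 0)
    {K K' : EuclideanSpace ℝ (Fin d) → ℂ} (hK : K =ᵐ[volume] K')
    {f f' : Fin m → EuclideanSpace ℝ (Fin d) → ℂ} (hf : ∀ j, f j =ᵐ[volume] f' j) :
    squareFunction θ K f = squareFunction θ K' f' := by
  ext x
  have h : ∀ l, pieceOp θ K l f x = pieceOp θ K' l f' x := fun l =>
    integral_congr_ae (multilinearIntegrand_congr_ae hθ0 hK hf l x)
  simp only [squareFunction, h]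

end SquareFunction

/-! ### The main theorem -/

theorem theorem1p1 (d m : ℕ) (hd : 1 ≤ d)
    (θ : Fin m → ℝ) (hθ0 : ∀ j, θ j ≠ 0) (hθ : Function.Injective θ)
    (p : ℝ≥0∞) (hp1 : 1 ≤ p) (hp : p < ∞)
    (q : Fin m → ℝ≥0∞) (hq2 : ∀ j, 2 ≤ q j) (hq : ∀ j, q j < ∞)
    (hpq : 1 / p = ∑ j, 1 / q j) :
    ∃ C : ℝ, 0 < C ∧
      ∀ K : EuclideanSpace ℝ (Fin d) → ℂ, AEStronglyMeasurable K volume →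
        SquareFunction.kernelConst p K < ∞ →
        ∀ f : Fin m → EuclideanSpace ℝ (Fin d) → ℂ, (∀ j, MemLp (f j) (q j) volume) →
          (∀ᵐ x ∂(volume : Measure (EuclideanSpace ℝ (Fin d))), ∀ l : Fin d → ℤ,
            Integrable (SquareFunction.multilinearIntegrand θ
              (SquareFunction.modulatedKernel K l) f x) volume) ∧
          MemLp (SquareFunction.squareFunction θ K f) p volume ∧
          eLpNorm (SquareFunction.squareFunction θ K f) p volume ≤
            ENNReal.ofReal C * SquareFunction.kernelConst p K *
              ∏ j, eLpNorm (f j) (q j) volume := by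
  open SquareFunction in
  obtain ⟨C, hC, hbound⟩ := exists_lintegral_tsum_cubeSquare_le (d := d) hθ hp1 hp hq2 hq hpq
  -- Adding 1 makes the constant strictly positive even if `C = 0`.
  refine ⟨C.toReal + 1, by positivity, fun K hK hB f hf => ?_⟩
  have hC' : C ≤ ENNReal.ofReal (C.toReal + 1) := by
    rw [ENNReal.le_ofReal_iff_toReal_le hC.ne (by positivity)]
    linarith
  have hp0 : p ≠ 0 := (zero_lt_one.trans_le hp1).ne'
  have hP0 : 0 < p.toReal := ENNReal.toReal_pos hp0 hp.ne
  -- The estimates need Borel functions on the product space, so the kernel and the `f j` are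
  -- replaced by measurable representatives.
  obtain ⟨K', hK'm, hKK'⟩ := hK
  choose f' hf'm hff' using fun j => (hf j).1
  rw [squareFunction_congr_ae hθ0 hKK' hff']
  rw [kernelConst_congr_ae p hKK'] at hB ⊢
  simp only [fun j => eLpNorm_congr_ae (p := q j) (hff' j)]
  have hfin : ∀ j, eLpNorm (f' j) (q j) volume < ∞ := fun j => by
    rw [← eLpNorm_congr_ae (hff' j)]; exact (hf j).2
  have hfm : ∀ j, Measurable (f' j) := fun j => (hf'm j).measurable
  have hH := hbound K' hK'm.measurable f' hfm
  have hRtop : C * kernelConst p K' * ∏ j, eLpNorm (f' j) (q j) volume < ∞ :=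
    ENNReal.mul_lt_top (ENNReal.mul_lt_top hC hB) (ENNReal.prod_lt_top fun j _ => hfin j)
  have hae : ∀ᵐ x ∂(volume : Measure (EuclideanSpace ℝ (Fin d))),
      Integrable (multilinearIntegrand θ K' f' x) volume := by
    have hlt : ∫⁻ x, (∑' u, cubeSquare θ K' f' u x) ^ p.toReal ≠ ∞ := fun h => by
      rw [h, ENNReal.top_rpow_of_pos (by positivity)] at hH
      exact hRtop.not_ge hH
    filter_upwards [ae_lt_top ((Measurable.tsum fun u =>
      measurable_cubeSquare θ hK'm.measurable hfm u).pow_const _) hlt] with x hx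
    exact integrable_multilinearIntegrand hK'm.measurable hfm
      ((ENNReal.rpow_lt_top_iff_of_pos hP0).1 hx)
  have hnorm : eLpNorm (squareFunction θ K' f') p volume ≤
      C * kernelConst p K' * ∏ j, eLpNorm (f' j) (q j) volume := by
    refine le_trans ?_ hH
    rw [eLpNorm_eq_lintegral_rpow_enorm_toReal hp0 hp.ne]
    refine ENNReal.rpow_le_rpow (lintegral_mono_ae ?_) (by positivity)
    filter_upwards [hae] with x hx
    rw [enorm_eq_self]
    exact ENNReal.rpow_le_rpow (squareFunction_le_tsum_cubeSquare hx) hP0.le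
  refine ⟨?_, ⟨(measurable_squareFunction θ hK'm.measurable hfm).aestronglyMeasurable,
    hnorm.trans_lt hRtop⟩, hnorm.trans (by gcongr)⟩
  filter_upwards [hae] with x hx l
  rw [integrable_congr (multilinearIntegrand_congr_ae hθ0 hKK' hff' l x)]
  simp only [funext fun y => multilinearIntegrand_modulatedKernel θ K' l f' x y]
  exact hx.mul_bdd (continuous_character l).aestronglyMeasurable
    (Filter.Eventually.of_forall fun y => (norm_character l y).le)
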